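/- A \emph{positive linear recurrence sequence} (PLRS) is a sequence of integers $(H_n)_{n\ge 1}$ for which there are an integer $L\ge 1$ and non-negative integers $c_1,\dots,c_L$ with $c_1>0$ and $c_L>0$ such that $H_1=1$, $H_{n+1}=c_1H_n+c_2H_{n-1}+\dots+c_nH_1+1$ for $1\le n<L$, and $H_{n+1}=c_1H_n+c_2H_{n-1}+\dots+c_LH_{n+1-L}$ for all $n\ge L$. Let $(F_n)_{n\ge1}$ be the Fibonacci numbers indexed as a PLRS (with $L=2$, $c_1=c_2=1$), that is, $F_1=1$, $F_2=2$ and $F_{n+1}=F_n+F_{n-1}$ for $n\ge 2$. For a PLRS $H$ and $m\ge 1$ let $t_{H,m}(n)$ be the number of compositions (ordered sums of positive integers) of $n$ all of whose parts belong to $\{H_i : i\ge m\}$, and let $r_m(n)=t_{F,m}(n)$. \textbf{Theorem.} Let $H$ be a PLRS. Then the following are equivalent: (i) for every $m\ge 2$ the limit $\lim_{n\to\infty} t_{H,m}(n)/r_m(n)$ exists and is finite and positive; (ii) $H_m=F_m$ for all $m\ge 1$. -/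

import Mathlib

/-- `H 1, H 2, H 3, …` is a positive linear recurrence sequence. The value `H 0` plays no role:
in both sums below the index `n + 1 - i` is at least `1`. -/
def IsPLRS (H : ℕ → ℤ) : Prop :=
  ∃ (L : ℕ) (c : ℕ → ℕ), 0 < L ∧ 0 < c 1 ∧ 0 < c L ∧
    (∀ n, L ≤ n → H (n + 1) = ∑ i ∈ Finset.Icc 1 L, (c i : ℤ) * H (n + 1 - i)) ∧
    H 1 = 1 ∧
    (∀ n, 1 ≤ n → n < L →
      H (n + 1) = (∑ i ∈ Finset.Icc 1 n, (c i : ℤ) * H (n + 1 - i)) + 1)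

/-- The Fibonacci numbers indexed as a positive linear recurrence sequence
(`L = 2`, `c₁ = c₂ = 1`): the terms of index `1, 2, 3, 4, …` are `1, 2, 3, 5, …`. -/
def fibSeq (n : ℕ) : ℤ := (Nat.fib (n + 1) : ℤ)

/-- The number of compositions of `n` all of whose parts lie in `{H i : i ≥ m}`. -/
noncomputable def compCount (H : ℕ → ℤ) (m n : ℕ) : ℕ :=
  Nat.card {c : Composition n // ∀ p ∈ c.blocks, ∃ i, m ≤ i ∧ (p : ℤ) = H i}

/-! Compositions with parts in a set `S` of positive integers have generating function `1 / (1 -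
g)`, where `g x = ∑_{p ∈ S} x ^ p`. A finite positive limit of the ratio makes both series converge
at the same `x ≥ 0`, so `g_H x < 1` iff `g_F x < 1` (`setGenFun_lt_one_iff`). If `θ F ≤ H` from
index `m` on with `θ > 1`, then `g_H x ≤ g_F (x ^ θ)` on `(0, 1]`, while some `x` there has `g_F (x
^ θ) < 1 ≤ g_F x`, a contradiction (`false_of_ratio`). The roles can be exchanged, except that a
constant `H` needs a separate argument. Since `m` is free, an eventual comparison suffices.

The comparison is `trichotomy`. Let `u` be the inverse golden ratio and `s = ∑ c_i u^i`. If `s < 1`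
or `s > 1`, then `u^n H_{n+1}` tends to `0` or `∞`, whereas `u^n F_{n+1}` tends to `1 / (u² √5)`. If
`s = 1`, a renewal argument gives the limit `(∑_{k<L} u^k) / μ`, with `μ` the mean of the
distribution `c_i u^i`. The numerator is below `1 / u²`, so `μ ≥ √5` puts the limit strictly below
that of `F`; otherwise the coefficients are `1, 0, …, 1, 0, 1, 1` and `H = F`
(`eq_fib_or_le_sum_tail`). -/

open Filter Topology Finset
open scoped ENNReal NNReal

/-! ### Convergence of sequences of weighted averages -/

section Averaging

variable {L : ℕ} {p v : ℕ → ℝ}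

/-- A lower bound of a sequence of weighted averages improves after `L` steps. -/
lemma averaging_lower_bound_improves (hp : ∀ i, 0 ≤ p i) (hs : ∑ i ∈ range L, p i = 1)
    (hL : 0 < L) (hrec : ∀ n, L ≤ n → v n = ∑ i ∈ range L, p i * v (n - 1 - i))
    {N : ℕ} {a : ℝ} (ha : ∀ n, N ≤ n → a ≤ v n) :
    ∀ n, N + L ≤ n → a + p 0 ^ L * (v (N + L) - a) ≤ v n := by
  have hp1 : p 0 ≤ 1 := by
    rw [← hs]
    exact single_le_sum (f := p) (fun i _ => hp i) (mem_range.2 hL)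
  have hz : 0 ≤ v (N + L) - a := sub_nonneg.2 (ha _ (by omega))
  have step : ∀ (b : ℝ) (n : ℕ), L ≤ n →
      v n - b = ∑ i ∈ range L, p i * (v (n - 1 - i) - b) := by
    intro b n hn
    simp only [mul_sub, sum_sub_distrib, ← sum_mul, hs, one_mul, ← hrec n hn]
  -- The weight `p 0` on the immediate predecessor passes the excess of `v (N + L)` over `a`
  -- forward, losing a factor `p 0` per step.
  have h1 : ∀ j, p 0 ^ j * (v (N + L) - a) ≤ v (N + L + j) - a := by
    intro j
    induction j with
    | zero => simp
    | succ j ih =>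
      rw [step a (N + L + (j + 1)) (by omega)]
      calc p 0 ^ (j + 1) * (v (N + L) - a) = p 0 * (p 0 ^ j * (v (N + L) - a)) := by ring
        _ ≤ p 0 * (v (N + L + j) - a) := mul_le_mul_of_nonneg_left ih (hp 0)
        _ = p 0 * (v (N + L + (j + 1) - 1 - 0) - a) := by congr 3
        _ ≤ _ := single_le_sum
            (f := fun i => p i * (v (N + L + (j + 1) - 1 - i) - a))
            (fun i hi => mul_nonneg (hp i) (sub_nonneg.2 (ha _ (by
              have := mem_range.1 hi; omega)))) (mem_range.2 hL)
  intro n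
  induction n using Nat.strong_induction_on with
  | _ n ih =>
    intro hn
    by_cases hlt : n < N + L + L
    · have h := h1 (n - (N + L))
      rw [show N + L + (n - (N + L)) = n by omega] at h
      have : p 0 ^ L ≤ p 0 ^ (n - (N + L)) :=
        pow_le_pow_of_le_one (hp 0) hp1 (by omega)
      nlinarith [mul_le_mul_of_nonneg_right this hz]
    · rw [← sub_nonneg, step _ n (by omega)]
      refine sum_nonneg fun i hi => mul_nonneg (hp i) (sub_nonneg.2 (ih _ ?_ ?_)) <;>
      · have := mem_range.1 hi
        omega

lemma averaging_range_shrinks (hp : ∀ i, 0 ≤ p i) (hs : ∑ i ∈ range L, p i = 1)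
    (hL : 0 < L) (hrec : ∀ n, L ≤ n → v n = ∑ i ∈ range L, p i * v (n - 1 - i))
    {a b : ℝ} (hab : ∀ n, a ≤ v n ∧ v n ≤ b) (k : ℕ) :
    ∃ (N : ℕ) (a' b' : ℝ), (∀ n, N ≤ n → a' ≤ v n ∧ v n ≤ b') ∧
      b' - a' = (1 - p 0 ^ L) ^ k * (b - a) := by
  induction k with
  | zero => exact ⟨0, a, b, fun n _ => hab n, by simp⟩
  | succ k ih =>
    obtain ⟨N, a', b', h, hd⟩ := ih
    refine ⟨N + L, a' + p 0 ^ L * (v (N + L) - a'), b' - p 0 ^ L * (b' - v (N + L)), ?_, ?_⟩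
    · intro n hn
      refine ⟨averaging_lower_bound_improves hp hs hL hrec (fun n hn => (h n hn).1) n hn, ?_⟩
      -- Both bounds are improved using the same term `v (N + L)`, which cancels when the two gains
      -- are added.
      have := averaging_lower_bound_improves (v := fun n => -v n) (a := -b') hp hs hL
        (fun n hn => by simp [hrec n hn]) (fun n hn => neg_le_neg (h n hn).2) n hn
      linarith
    · rw [pow_succ]
      linear_combination (1 - p 0 ^ L) * hd

/-- A sequence of weighted averages with a conserved positive functional converges. -/
lemma averaging_tendsto (hp : ∀ i, 0 ≤ p i) (hp0 : 0 < p 0) (hs : ∑ i ∈ range L, p i = 1)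
    (hL : 0 < L) (hrec : ∀ n, L ≤ n → v n = ∑ i ∈ range L, p i * v (n - 1 - i))
    {a b : ℝ} (hab : ∀ n, a ≤ v n ∧ v n ≤ b) {τ : ℕ → ℝ} {w : ℝ} (hτ : ∀ j, 0 ≤ τ j)
    (hμ : 0 < ∑ j ∈ range L, τ j)
    (hw : ∀ n, L ≤ n → ∑ j ∈ range L, τ j * v (n - j) = w) :
    Tendsto v atTop (𝓝 (w / ∑ j ∈ range L, τ j)) := by
  have hp1 : p 0 ≤ 1 := by
    rw [← hs]
    exact single_le_sum (f := p) (fun i _ => hp i) (mem_range.2 hL)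
  have hq : Tendsto (fun k : ℕ => (1 - p 0 ^ L) ^ k * (b - a)) atTop (𝓝 0) := by
    rw [← zero_mul (b - a)]
    refine (tendsto_pow_atTop_nhds_zero_of_lt_one ?_ ?_).mul_const _
    · exact sub_nonneg.2 (pow_le_one₀ (hp 0) hp1)
    · linarith [pow_pos hp0 L]
  rw [Metric.tendsto_atTop]
  intro ε hε
  obtain ⟨k, hk⟩ := (hq.eventually (gt_mem_nhds hε)).exists
  obtain ⟨N, a', b', h, hd⟩ := averaging_range_shrinks hp hs hL hrec hab k
  refine ⟨N, fun n hn => ?_⟩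
  have hwN := hw (N + L) (by omega)
  -- The candidate limit is a weighted mean of terms lying in `[a', b']`, so it is trapped in the
  -- same short interval as `v n`.
  have hlo : a' ≤ w / ∑ j ∈ range L, τ j := by
    rw [le_div_iff₀ hμ, ← hwN, mul_sum]
    refine sum_le_sum fun j hj => ?_
    rw [mul_comm]
    exact mul_le_mul_of_nonneg_left (h _ (by have := mem_range.1 hj; omega)).1 (hτ j)
  have hhi : w / ∑ j ∈ range L, τ j ≤ b' := by
    rw [div_le_iff₀ hμ, ← hwN, mul_sum]
    refine sum_le_sum fun j hj => ?_
    rw [mul_comm b']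
    exact mul_le_mul_of_nonneg_left (h _ (by have := mem_range.1 hj; omega)).2 (hτ j)
  rw [Real.dist_eq, abs_lt]
  have := h n hn
  constructor <;> linarith

end Averaging

/-! ### Growth of positive linear recurrences -/

/-- The data of a positive linear recurrence in shifted form: `h n` stands for `H (n + 1)`,
`a i` for `c (i + 1)`, and the coefficients beyond `L` vanish. -/
structure IsShiftedPLRS (L : ℕ) (a : ℕ → ℕ) (h : ℕ → ℝ) : Prop where
  pos : 0 < L
  first_pos : 0 < a 0
  last_pos : 0 < a (L - 1)
  eq_zero : ∀ i, L ≤ i → a i = 0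
  eq_sum : ∀ n, h n = ∑ i ∈ range n, (a i : ℝ) * h (n - 1 - i) + if n < L then 1 else 0

namespace IsShiftedPLRS

variable {L : ℕ} {a : ℕ → ℕ} {h : ℕ → ℝ} {u : ℝ}

lemma nonneg (H : IsShiftedPLRS L a h) (n : ℕ) : 0 ≤ h n := by
  induction n using Nat.strong_induction_on with
  | _ n ih =>
    rw [H.eq_sum]
    refine add_nonneg (sum_nonneg fun i hi => mul_nonneg (by positivity) (ih _ ?_)) ?_
    · have := mem_range.1 hi
      omega
    · split_ifs <;> norm_num

lemma one_le (H : IsShiftedPLRS L a h) {n : ℕ} (hn : n < L) : 1 ≤ h n := by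
  rw [H.eq_sum, if_pos hn, le_add_iff_nonneg_left]
  exact sum_nonneg fun i _ => mul_nonneg (by positivity) (H.nonneg _)

lemma scaled_eq (H : IsShiftedPLRS L a h) (n : ℕ) :
    u ^ n * h n = ∑ i ∈ range n, (a i * u ^ (i + 1)) * (u ^ (n - 1 - i) * h (n - 1 - i))
      + if n < L then u ^ n else 0 := by
  rw [H.eq_sum, mul_add, mul_sum, mul_ite, mul_one, mul_zero]
  congr 1
  refine sum_congr rfl fun i hi => ?_
  have : u ^ n = u ^ (i + 1) * u ^ (n - 1 - i) := by
    rw [← pow_add]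
    congr 1
    have := mem_range.1 hi
    omega
  rw [this]
  ring

lemma scaled_rec (H : IsShiftedPLRS L a h) (n : ℕ) (hn : L ≤ n) :
    u ^ n * h n = ∑ i ∈ range L, (a i * u ^ (i + 1)) * (u ^ (n - 1 - i) * h (n - 1 - i)) := by
  rw [H.scaled_eq, if_neg (by omega), add_zero]
  refine (sum_subset (range_subset_range.2 hn) fun i _ hi => ?_).symm
  rw [H.eq_zero i (by simpa using hi)]
  simp

lemma scaled_bounded (H : IsShiftedPLRS L a h) (hu : 0 < u)
    (hs : ∑ i ∈ range L, (a i * u ^ (i + 1)) ≤ 1) :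
    ∃ B, 0 ≤ B ∧ ∀ n, u ^ n * h n ≤ B := by
  have hnn : ∀ n, 0 ≤ u ^ n * h n := fun n => mul_nonneg (by positivity) (H.nonneg n)
  have hB : 0 ≤ ∑ i ∈ range L, u ^ i * h i := sum_nonneg fun i _ => hnn i
  refine ⟨∑ i ∈ range L, u ^ i * h i, hB, fun n => ?_⟩
  induction n using Nat.strong_induction_on with
  | _ n ih =>
    by_cases hn : n < L
    · exact single_le_sum (f := fun i => u ^ i * h i) (fun i _ => hnn i) (mem_range.2 hn)
    · rw [H.scaled_rec n (by omega)]
      refine (sum_le_sum fun i hi => mul_le_mul_of_nonneg_left (ih (n - 1 - i) ?_)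
        (by positivity)).trans ?_
      · have := H.pos
        omega
      · rw [← sum_mul]
        exact mul_le_of_le_one_left hB hs

lemma scaled_tendsto_zero (H : IsShiftedPLRS L a h) (hu : 0 < u)
    (hs : ∑ i ∈ range L, (a i * u ^ (i + 1)) < 1) :
    Tendsto (fun n => u ^ n * h n) atTop (𝓝 0) := by
  obtain ⟨B, hB, hb⟩ := H.scaled_bounded hu hs.le
  set s := ∑ i ∈ range L, (a i * u ^ (i + 1)) with hs_def
  have hs0 : 0 ≤ s := sum_nonneg fun i _ => by positivity
  -- A term is a combination of the `L` preceding ones with total weight `s`, so each further block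
  -- of `L` indices gains a factor `s`.
  have key : ∀ k n, k * L ≤ n → u ^ n * h n ≤ s ^ k * B := by
    intro k
    induction k with
    | zero => intro n _; simpa using hb n
    | succ k ih =>
      intro n hn
      rw [H.scaled_rec n (by nlinarith)]
      refine (sum_le_sum fun i hi => mul_le_mul_of_nonneg_left (ih (n - 1 - i) ?_)
        (by positivity)).trans_eq ?_
      · have := mem_range.1 hi
        rw [add_mul] at hn
        omega
      · rw [← sum_mul, ← hs_def, pow_succ]
        ring
  have hq : Tendsto (fun k : ℕ => s ^ k * B) atTop (𝓝 0) := by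
    rw [← zero_mul B]
    exact (tendsto_pow_atTop_nhds_zero_of_lt_one hs0 hs).mul_const _
  rw [Metric.tendsto_atTop]
  intro ε hε
  obtain ⟨k, hk⟩ := (hq.eventually (gt_mem_nhds hε)).exists
  refine ⟨k * L, fun n hn => ?_⟩
  rw [Real.dist_eq, sub_zero, abs_of_nonneg (mul_nonneg (by positivity) (H.nonneg n))]
  exact (key k n hn).trans_lt hk

lemma scaled_tendsto_atTop (H : IsShiftedPLRS L a h) (hu : 0 < u) (hu1 : u < 1)
    (hs : 1 < ∑ i ∈ range L, (a i * u ^ (i + 1))) :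
    Tendsto (fun n => u ^ n * h n) atTop atTop := by
  set s := ∑ i ∈ range L, (a i * u ^ (i + 1)) with hs_def
  have hb0 : 0 < u ^ L := by positivity
  have hb : ∀ n, u ^ L ≤ u ^ n * h n := by
    intro n
    induction n using Nat.strong_induction_on with
    | _ n ih =>
      by_cases hn : n < L
      · exact (pow_le_pow_of_le_one hu.le hu1.le hn.le).trans
          (le_mul_of_one_le_right (by positivity) (H.one_le hn))
      · rw [H.scaled_rec n (by omega)]
        refine le_trans ?_ (sum_le_sum fun i hi => mul_le_mul_of_nonneg_left
          (ih (n - 1 - i) (by have := H.pos; omega)) (by positivity))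
        rw [← sum_mul, ← hs_def]
        exact le_mul_of_one_le_left hb0.le hs.le
  have key : ∀ k n, k * L ≤ n → s ^ k * u ^ L ≤ u ^ n * h n := by
    intro k
    induction k with
    | zero => intro n _; simpa using hb n
    | succ k ih =>
      intro n hn
      rw [H.scaled_rec n (by nlinarith)]
      refine le_trans (le_of_eq ?_) (sum_le_sum fun i hi => mul_le_mul_of_nonneg_left
        (ih (n - 1 - i) ?_) (by positivity))
      · rw [← sum_mul, ← hs_def, pow_succ]
        ring
      · have := mem_range.1 hi
        rw [add_mul] at hn
        omega
  have hq : Tendsto (fun k : ℕ => s ^ k * u ^ L) atTop atTop :=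
    (tendsto_pow_atTop_atTop_of_one_lt hs).atTop_mul_const hb0
  rw [tendsto_atTop]
  intro B
  obtain ⟨k, hk⟩ := (hq.eventually (eventually_ge_atTop B)).exists
  filter_upwards [eventually_ge_atTop (k * L)] with n hn
  exact hk.trans (key k n hn)

/-! ### Tail weights and the renewal limit -/

/-- The tail weights `1 - ∑_{i < j} a_i u^{i+1}`. -/
noncomputable def tail (a : ℕ → ℕ) (u : ℝ) (j : ℕ) : ℝ := 1 - ∑ i ∈ range j, (a i * u ^ (i + 1))

lemma tail_zero : tail a u 0 = 1 := by simp [tail]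

lemma tail_succ (j : ℕ) : tail a u (j + 1) = tail a u j - a j * u ^ (j + 1) := by
  simp only [tail, sum_range_succ]
  ring

lemma tail_eq_zero (H : IsShiftedPLRS L a h) (hs : ∑ i ∈ range L, (a i * u ^ (i + 1)) = 1)
    {j : ℕ} (hj : L ≤ j) : tail a u j = 0 := by
  rw [tail, ← sum_subset (range_subset_range.2 hj), hs, sub_self]
  intro i _ hi
  rw [H.eq_zero i (by simpa using hi)]
  simp

lemma tail_anti (hu : 0 < u) : Antitone (tail a u) :=
  antitone_nat_of_succ_le fun j => by
    rw [tail_succ]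
    have : 0 ≤ a j * u ^ (j + 1) := by positivity
    linarith

lemma tail_nonneg (H : IsShiftedPLRS L a h) (hu : 0 < u)
    (hs : ∑ i ∈ range L, (a i * u ^ (i + 1)) = 1) (j : ℕ) : 0 ≤ tail a u j := by
  rw [← H.tail_eq_zero hs (le_max_right j L)]
  exact tail_anti hu (le_max_left j L)

/-- Summation by parts: consecutive tails differ by the recurrence weights, so passing from `n` to
`n + 1` adds only the inhomogeneous term. That term vanishes from `L` on, which yields the conserved
functional that identifies the limit. -/
lemma sum_tail_mul_scaled (H : IsShiftedPLRS L a h) (n : ℕ) :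
    ∑ j ∈ range (n + 1), tail a u j * (u ^ (n - j) * h (n - j))
      = ∑ k ∈ range (n + 1), if k < L then u ^ k else 0 := by
  induction n with
  | zero =>
    have h0 := H.eq_sum 0
    rw [range_zero, sum_empty, zero_add, if_pos H.pos] at h0
    simp [tail_zero, H.pos, h0]
  | succ n ih =>
    rw [sum_range_succ', sum_range_succ _ (n + 1), ← ih, tail_zero, one_mul, Nat.sub_zero,
      H.scaled_eq (n + 1), ← add_assoc, ← sum_add_distrib]
    congr 1
    refine sum_congr rfl fun j _ => ?_
    rw [tail_succ, show n + 1 - (j + 1) = n - j by omega, show n + 1 - 1 - j = n - j by omega]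
    ring

lemma scaled_tendsto (H : IsShiftedPLRS L a h) (hu : 0 < u)
    (hs : ∑ i ∈ range L, (a i * u ^ (i + 1)) = 1) :
    Tendsto (fun n => u ^ n * h n) atTop
      (𝓝 ((∑ k ∈ range L, u ^ k) / ∑ j ∈ range L, tail a u j)) := by
  obtain ⟨B, -, hB⟩ := H.scaled_bounded hu hs.le
  have ha := H.first_pos
  refine averaging_tendsto (p := fun i => a i * u ^ (i + 1)) (fun i => by positivity)
    (by positivity) hs H.pos (fun n hn => H.scaled_rec n hn)
    (fun n => ⟨mul_nonneg (by positivity) (H.nonneg n), hB n⟩) (H.tail_nonneg hu hs) ?_ ?_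
  · refine lt_of_lt_of_le one_pos ?_
    rw [← tail_zero (a := a) (u := u)]
    exact single_le_sum (f := tail a u) (fun j _ => H.tail_nonneg hu hs j) (mem_range.2 H.pos)
  · intro n hn
    have hsub : range L ⊆ range (n + 1) := range_subset_range.2 (by omega)
    rw [sum_subset hsub, H.sum_tail_mul_scaled, ← sum_subset hsub]
    · exact sum_congr rfl fun k hk => if_pos (mem_range.1 hk)
    · intro k _ hk
      exact if_neg (by simpa using hk)
    · intro j _ hj
      rw [H.tail_eq_zero hs (by simpa using hj), zero_mul]

end IsShiftedPLRS

/-! ### Passage to the shifted form -/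

lemma IsPLRS.exists_isShiftedPLRS {H : ℕ → ℤ} (hH : IsPLRS H) :
    ∃ L a, IsShiftedPLRS L a (fun n => (H (n + 1) : ℝ)) := by
  obtain ⟨L, c, hL, hc1, hcL, hrec, h1, hinit⟩ := hH
  -- The values of `c` beyond `L` are arbitrary; cutting them off lets one sum over `range n` cover
  -- both clauses of the recurrence.
  refine ⟨L, fun i => if i < L then c (i + 1) else 0, hL, by simpa [hL] using hc1, ?_,
    fun i hi => if_neg (by omega), fun n => ?_⟩
  · have : L - 1 < L := by omega
    simpa [this, Nat.sub_add_cancel hL] using hcL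
  · have hIcc : ∀ k, ∑ i ∈ Icc 1 k, (c i : ℤ) * H (n + 1 - i)
        = ∑ i ∈ range k, (c (i + 1) : ℤ) * H (n - i) := by
      intro k
      rw [range_eq_Ico, ← Ico_succ_right_eq_Icc, Order.succ_eq_add_one,
        ← sum_Ico_add' (fun i => (c i : ℤ) * H (n + 1 - i)) 0 k 1]
      exact sum_congr rfl fun i _ => by rw [Nat.add_sub_add_right]
    have hidx : ∀ i ∈ range n, n - 1 - i + 1 = n - i := fun i hi => by
      have := mem_range.1 hi
      omega
    by_cases hn : n < L
    · have hsum : H (n + 1) = ∑ i ∈ range n, (c (i + 1) : ℤ) * H (n - i) + 1 := by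
        rcases Nat.eq_zero_or_pos n with rfl | hpos
        · simpa using h1
        · rw [hinit n hpos hn, hIcc]
      rw [if_pos hn, hsum]
      push_cast
      congr 1
      refine sum_congr rfl fun i hi => ?_
      rw [if_pos (by have := mem_range.1 hi; omega), hidx i hi]
    · rw [if_neg hn, hrec n (by omega), hIcc, add_zero,
        ← sum_subset (range_subset_range.2 (not_lt.1 hn))]
      · push_cast
        refine sum_congr rfl fun i hi => ?_
        have := mem_range.1 hi
        rw [if_pos this, hidx i (mem_range.2 (by omega))]
      · intro i _ hi
        rw [if_neg (by simpa using hi)]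
        simp

lemma isShiftedPLRS_fibSeq :
    IsShiftedPLRS 2 (fun i => if i < 2 then 1 else 0) (fun n => (fibSeq (n + 1) : ℝ)) := by
  refine ⟨by norm_num, by norm_num, by norm_num, fun i hi => if_neg (by omega), fun n => ?_⟩
  match n with
  | 0 => simp [fibSeq]
  | 1 =>
    rw [sum_range_one]
    norm_num [fibSeq, Nat.fib_add_two]
  | n + 2 =>
    rw [sum_range_succ', sum_range_succ']
    have : Nat.fib (n + 4) = Nat.fib (n + 2) + Nat.fib (n + 3) := Nat.fib_add_two
    simp [fibSeq, this]

/-! ### Comparison with the Fibonacci numbers -/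

namespace IsShiftedPLRS

variable {L : ℕ} {a : ℕ → ℕ} {h : ℕ → ℝ} {u : ℝ}

lemma unique {h' : ℕ → ℝ} (H : IsShiftedPLRS L a h)
    (h_eq : ∀ n, h' n = ∑ i ∈ range n, (a i : ℝ) * h' (n - 1 - i) + if n < L then 1 else 0)
    (n : ℕ) : h n = h' n := by
  induction n using Nat.strong_induction_on with
  | _ n ih =>
    rw [H.eq_sum, h_eq]
    congr 1
    refine sum_congr rfl fun i hi => ?_
    rw [ih _ (by have := mem_range.1 hi; omega)]

/-- The coefficients `1, 0, 1, 0, …, 1, 0, 1, 1` generate the Fibonacci numbers. -/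
lemma eq_fib_of_alternating (H : IsShiftedPLRS L a h) {k : ℕ}
    (hpre : ∀ j < k, a (2 * j) = 1 ∧ a (2 * j + 1) = 0) (h1 : a (2 * k) = 1)
    (h2 : a (2 * k + 1) = 1) (hL : L = 2 * k + 2) (n : ℕ) : h n = (Nat.fib (n + 2) : ℝ) := by
  refine H.unique (h' := fun n => (Nat.fib (n + 2) : ℝ)) (fun n => ?_) n
  -- Repeatedly expanding the smaller summand in `F_{r+4} = F_{r+3} + F_{r+2}` produces the
  -- coefficients `1, 0, 1, 0, …`.
  have heven : ∀ j, j ≤ k → ∀ r, n = 2 * j + r →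
      (Nat.fib (n + 2) : ℝ) = ∑ i ∈ range (2 * j), (a i : ℝ) * Nat.fib (n - 1 - i + 2)
        + Nat.fib (r + 2) := by
    intro j
    induction j with
    | zero => intro _ r hr; simp [hr]
    | succ j ih =>
      intro hj r hr
      rw [ih (by omega) (r + 2) (by omega), show 2 * (j + 1) = 2 * j + 1 + 1 by ring,
        sum_range_succ, sum_range_succ, (hpre j (by omega)).1, (hpre j (by omega)).2,
        show n - 1 - 2 * j + 2 = r + 3 by omega]
      have : Nat.fib (r + 2 + 2) = Nat.fib (r + 2) + Nat.fib (r + 3) := Nat.fib_add_two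
      rw [this]
      push_cast
      ring
  have hodd : ∀ j, j ≤ k → ∀ r, n = 2 * j + 1 + r →
      (Nat.fib (n + 2) : ℝ) = ∑ i ∈ range (2 * j + 1), (a i : ℝ) * Nat.fib (n - 1 - i + 2)
        + Nat.fib (r + 1) := by
    intro j hj r hr
    have ha : a (2 * j) = 1 := by
      rcases hj.lt_or_eq with hlt | rfl
      · exact (hpre j hlt).1
      · exact h1
    rw [heven j hj (r + 1) (by omega), sum_range_succ, ha,
      show n - 1 - 2 * j + 2 = r + 2 by omega]
    have : Nat.fib (r + 1 + 2) = Nat.fib (r + 1) + Nat.fib (r + 2) := Nat.fib_add_two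
    rw [this]
    push_cast
    ring
  by_cases hn : n < L
  · rw [if_pos hn]
    obtain ⟨j, hj | hj⟩ := Nat.even_or_odd' n
    · have := heven j (by omega) 0 (by omega)
      rw [← hj] at this
      simpa using this
    · have := hodd j (by omega) 0 (by omega)
      rw [← hj] at this
      simpa using this
  · rw [if_neg hn, add_zero, hodd k le_rfl (n - (2 * k + 1)) (by omega),
      ← sum_subset (range_subset_range.2 (show 2 * k + 1 + 1 ≤ n by omega)), sum_range_succ _
      (2 * k + 1), h2, show n - 1 - (2 * k + 1) + 2 = n - (2 * k + 1) + 1 by omega]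
    · simp
    · intro i _ hi
      rw [H.eq_zero i (by rw [hL]; simp at hi; omega)]
      simp

/-- A pair `1, 0` takes `u ^ (2j+1)` off the tail `u ^ (2j)` and leaves `u ^ (2j+2)`, as `1 - u =
u²`. The tail sum is then geometric, with `1 + u² = (1 + 2u)(1 - u²)`. -/
lemma tail_of_alternating (hu : u ^ 2 + u = 1) {k : ℕ}
    (hpre : ∀ j < k, a (2 * j) = 1 ∧ a (2 * j + 1) = 0) :
    tail a u (2 * k) = u ^ (2 * k) ∧
      ∑ j ∈ range (2 * k), tail a u j = (1 + 2 * u) * (1 - u ^ (2 * k)) := by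
  induction k with
  | zero => simp [tail_zero]
  | succ k ih =>
    obtain ⟨h1, h2⟩ := ih fun j hj => hpre j (by omega)
    have h3 : tail a u (2 * k + 1) = u ^ (2 * k) * (1 - u) := by
      rw [tail_succ, h1, (hpre k (by omega)).1]
      push_cast
      ring
    have h4 : tail a u (2 * k + 2) = u ^ (2 * k) * (1 - u) := by
      rw [tail_succ, h3, (hpre k (by omega)).2]
      simp
    have h5 : u ^ (2 * (k + 1)) = u ^ (2 * k) * (1 - u) := by
      rw [← hu]
      ring
    refine ⟨by rw [h5]; exact h4, ?_⟩
    rw [show 2 * (k + 1) = 2 * k + 1 + 1 by ring, sum_range_succ, sum_range_succ, h2, h1, h3,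
      show 2 * k + 1 + 1 = 2 * (k + 1) by ring, h5]
    linear_combination -2 * u ^ (2 * k) * hu

/-- If the characteristic equation holds at the inverse golden ratio, then either the mean of the
coefficient distribution is at least `√5 = 1 + 2u`, or the sequence is the Fibonacci sequence. -/
lemma eq_fib_or_le_sum_tail (H : IsShiftedPLRS L a h) (hu0 : 0 < u) (hu : u ^ 2 + u = 1)
    (hs : ∑ i ∈ range L, (a i * u ^ (i + 1)) = 1) :
    (∀ n, h n = (Nat.fib (n + 2) : ℝ)) ∨ 1 + 2 * u ≤ ∑ j ∈ range L, tail a u j := by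
  have hlo : 1 / 2 < u := by nlinarith
  have hhi : u < 2 / 3 := by nlinarith
  have hex : ∃ k, ¬ (a (2 * k) = 1 ∧ a (2 * k + 1) = 0) := by
    refine ⟨L, fun hk => ?_⟩
    rw [H.eq_zero (2 * L) (by omega)] at hk
    exact absurd hk.1 (by norm_num)
  classical
  -- The first pair of coefficients that departs from `1, 0` decides the case.
  obtain ⟨k, hk, hpre⟩ : ∃ k, ¬ (a (2 * k) = 1 ∧ a (2 * k + 1) = 0) ∧
      ∀ j < k, a (2 * j) = 1 ∧ a (2 * j + 1) = 0 :=
    ⟨Nat.find hex, Nat.find_spec hex, fun j hj => not_not.1 (Nat.find_min hex hj)⟩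
  obtain ⟨ht, hsum⟩ := tail_of_alternating hu hpre
  have hU : 0 < u ^ (2 * k) := by positivity
  have ht1 : tail a u (2 * k + 1) = u ^ (2 * k) * (1 - a (2 * k) * u) := by
    rw [tail_succ, ht]
    ring
  have ht2 : tail a u (2 * k + 2)
      = u ^ (2 * k) * (1 - a (2 * k) * u - a (2 * k + 1) * u ^ 2) := by
    rw [tail_succ, ht1]
    ring
  have hp1 : 0 ≤ 1 - a (2 * k) * u := by
    have := H.tail_nonneg hu0 hs (2 * k + 1)
    rw [ht1] at this
    exact nonneg_of_mul_nonneg_right this hU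
  have hp2 : 0 ≤ 1 - a (2 * k) * u - a (2 * k + 1) * u ^ 2 := by
    have := H.tail_nonneg hu0 hs (2 * k + 2)
    rw [ht2] at this
    exact nonneg_of_mul_nonneg_right this hU
  -- The remaining mass is `u ^ (2k)`, and `2u > 1`.
  have ha : a (2 * k) ≤ 1 := by
    by_contra! hc
    have : (2 : ℝ) ≤ a (2 * k) := by exact_mod_cast hc
    nlinarith
  interval_cases h0 : a (2 * k)
  · right
    have hb : a (2 * k + 1) ≤ 2 := by
      by_contra! hc
      have : (3 : ℝ) ≤ a (2 * k + 1) := by exact_mod_cast hc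
      nlinarith
    have hb' : (a (2 * k + 1) : ℝ) ≤ 2 := by exact_mod_cast hb
    -- Three more tails suffice: since `a (2k+1) ≤ 2`, they add at least `u ^ (2k) (3 - 2u²) = u ^
    -- (2k) (1 + 2u)`, exactly the amount missing from `1 + 2u`.
    have hext : ∑ j ∈ range (2 * k + 3), tail a u j ≤ ∑ j ∈ range L, tail a u j := by
      by_cases hle : 2 * k + 3 ≤ L
      · exact sum_le_sum_of_subset_of_nonneg (range_subset_range.2 hle)
          fun j _ _ => H.tail_nonneg hu0 hs j
      · rw [← sum_subset (range_subset_range.2 (show L ≤ 2 * k + 3 by omega))]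
        intro j _ hj
        exact H.tail_eq_zero hs (by simpa using hj)
    refine le_trans ?_ hext
    rw [sum_range_succ, sum_range_succ, sum_range_succ, hsum, ht, ht1, ht2]
    push_cast
    have : (1 - 2 * u ^ 2) ≤ 1 - 0 * u - a (2 * k + 1) * u ^ 2 := by nlinarith
    nlinarith [mul_le_mul_of_nonneg_left this hU.le]
  · left
    have hb : a (2 * k + 1) ≤ 1 := by
      by_contra! hc
      have : (2 : ℝ) ≤ a (2 * k + 1) := by exact_mod_cast hc
      push_cast at hp2
      nlinarith
    have hb1 : a (2 * k + 1) = 1 := by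
      have : a (2 * k + 1) ≠ 0 := fun h => hk ⟨rfl, h⟩
      omega
    -- The pair `1, 1` exhausts the mass, since `u + u² = 1`; positivity of the last coefficient
    -- then forces `L = 2k + 2`.
    have hzero : tail a u (2 * k + 2) = 0 := by
      rw [ht2, hb1]
      push_cast
      linear_combination -u ^ (2 * k) * hu
    have hLge : 2 * k + 2 ≤ L := by
      by_contra! hc
      have := H.eq_zero (2 * k + 1) (by omega)
      omega
    have hLle : L ≤ 2 * k + 2 := by
      by_contra! hc
      have h1 : tail a u (L - 1) ≤ 0 := hzero ▸ tail_anti hu0 (by omega)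
      have h2 := tail_succ (a := a) (u := u) (L - 1)
      have := H.last_pos
      rw [H.tail_eq_zero hs (by omega)] at h2
      have : 0 < a (L - 1) * u ^ (L - 1 + 1) := by positivity
      linarith
    exact H.eq_fib_of_alternating hpre h0 hb1 (by omega)

lemma exists_ratio_of_tendsto {v w : ℕ → ℝ} {κ g : ℝ} (hκ : 0 ≤ κ) (hg : κ < g)
    (hv : Tendsto v atTop (𝓝 κ)) (hw : Tendsto w atTop (𝓝 g)) :
    ∃ θ : ℝ, 1 < θ ∧ ∀ᶠ n in atTop, θ * v n ≤ w n := by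
  -- Since `κ` may be `0`, the ratio is taken between two intermediate values rather than as `g /
  -- κ`.
  obtain ⟨c, hc1, hc2⟩ := exists_between hg
  obtain ⟨b, hb1, hb2⟩ := exists_between hc1
  have hb : 0 < b := hκ.trans_lt hb1
  refine ⟨c / b, (one_lt_div hb).2 hb2, ?_⟩
  filter_upwards [hv.eventually (gt_mem_nhds hb1), hw.eventually (lt_mem_nhds hc2)] with n h1 h2
  calc c / b * v n ≤ c / b * b :=
        mul_le_mul_of_nonneg_left h1.le (div_nonneg (hb.trans hb2).le hb.le)
    _ = c := div_mul_cancel₀ c hb.ne'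
    _ ≤ w n := h2.le

/-- A positive linear recurrence sequence is the Fibonacci sequence, or is eventually larger or
eventually smaller than it by a constant factor. -/
theorem trichotomy (H : IsShiftedPLRS L a h) :
    (∀ n, h n = fibSeq (n + 1)) ∨
      (∃ θ : ℝ, 1 < θ ∧ ∀ᶠ n in atTop, θ * fibSeq (n + 1) ≤ h n) ∨
      (∃ θ : ℝ, 1 < θ ∧ ∀ᶠ n in atTop, θ * h n ≤ fibSeq (n + 1)) := by
  obtain ⟨u, hu0, hu⟩ : ∃ u : ℝ, 0 < u ∧ u ^ 2 + u = 1 := by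
    have h5 : √5 ^ 2 = (5 : ℝ) := Real.sq_sqrt (by norm_num)
    refine ⟨(√5 - 1) / 2, ?_, ?_⟩
    · have : (1 : ℝ) < √5 := Real.lt_sqrt_of_sq_lt (by norm_num)
      linarith
    · linear_combination h5 / 4
  have hu1 : u < 1 := by nlinarith
  have unscale : ∀ {θ x y : ℝ} (n : ℕ), θ * (u ^ n * x) ≤ u ^ n * y → θ * x ≤ y := by
    intro θ x y n hle
    refine le_of_mul_le_mul_left ?_ (pow_pos hu0 n)
    linarith
  have hf := isShiftedPLRS_fibSeq.scaled_tendsto hu0 (by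
    simp only [sum_range_succ, range_zero, sum_empty]
    norm_num
    linarith)
  have hg : (∑ k ∈ range 2, u ^ k) / ∑ j ∈ range 2,
      tail (fun i => if i < 2 then 1 else 0) u j = 1 / (u ^ 2 * (1 + 2 * u)) := by
    simp only [sum_range_succ, range_zero, sum_empty, tail]
    norm_num
    have : 1 + (1 - u) ≠ 0 := by linarith
    field_simp
    linear_combination (2 * u ^ 2 + u + 2) * hu
  rw [hg] at hf
  have hgpos : 0 < 1 / (u ^ 2 * (1 + 2 * u)) := by positivity
  rcases lt_trichotomy (∑ i ∈ range L, (a i * u ^ (i + 1))) 1 with hs | hs | hs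
  · right; right
    obtain ⟨θ, hθ, hev⟩ := exists_ratio_of_tendsto le_rfl hgpos (H.scaled_tendsto_zero hu0 hs) hf
    exact ⟨θ, hθ, hev.mono fun n hn => unscale n hn⟩
  · rcases H.eq_fib_or_le_sum_tail hu0 hu hs with hfib | hμ
    · left
      intro n
      simp [hfib n, fibSeq]
    · right; right
      -- The finite geometric sum stays strictly below `1 / (1 - u) = 1 / u²`; this keeps the gap
      -- strict even when the mean equals `1 + 2u`.
      have hgeom : (∑ k ∈ range L, u ^ k) * u ^ 2 < 1 := by
        have h1 := geom_sum_mul_neg u L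
        have : u ^ 2 = 1 - u := by linarith
        rw [this, h1]
        linarith [pow_pos hu0 L]
      have hlt : (∑ k ∈ range L, u ^ k) / ∑ j ∈ range L, tail a u j
          < 1 / (u ^ 2 * (1 + 2 * u)) := by
        have hμ0 : 0 < ∑ j ∈ range L, tail a u j := by linarith
        rw [div_lt_div_iff₀ hμ0 (by positivity)]
        nlinarith
      obtain ⟨θ, hθ, hev⟩ := exists_ratio_of_tendsto
        (div_nonneg (sum_nonneg fun k _ => by positivity)
          (sum_nonneg fun j _ => H.tail_nonneg hu0 hs j)) hlt (H.scaled_tendsto hu0 hs) hf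
      exact ⟨θ, hθ, hev.mono fun n hn => unscale n hn⟩
  · right; left
    refine ⟨2, by norm_num, ?_⟩
    have ht := H.scaled_tendsto_atTop hu0 hu1 hs
    filter_upwards [ht.eventually (eventually_ge_atTop (2 * (1 / (u ^ 2 * (1 + 2 * u)) + 1))),
      hf.eventually (gt_mem_nhds (lt_add_one _))] with n h1 h2
    exact unscale n (by linarith)

end IsShiftedPLRS

/-! ### Generating functions of compositions -/

/-- The set `{H i : i ≥ m}` of admissible parts. -/
def partSet (H : ℕ → ℤ) (m : ℕ) : Set ℕ := {p | ∃ i, m ≤ i ∧ (p : ℤ) = H i}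

/-- The generating function `∑_{p ∈ S} x ^ p` of a set of natural numbers. -/
noncomputable def setGenFun (S : Set ℕ) (x : ℝ≥0) : ℝ≥0∞ := ∑' p : S, (x : ℝ≥0∞) ^ (p : ℕ)

lemma setGenFun_mono (S : Set ℕ) : Monotone (setGenFun S) := fun _ _ hxy =>
  ENNReal.tsum_le_tsum fun _ => pow_le_pow_left₀ (zero_le) (ENNReal.coe_le_coe.2 hxy) _

lemma tsum_tuples (S : Set ℕ) (x : ℝ≥0) (k : ℕ) :
    ∑' f : Fin k → S, (x : ℝ≥0∞) ^ (∑ i, (f i : ℕ)) = setGenFun S x ^ k := by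
  induction k with
  | zero => simp
  | succ k ih =>
    rw [← (Fin.consEquiv fun _ => S).tsum_eq, ENNReal.tsum_prod (f := fun (p : S)
      (f : Fin k → S) => (x : ℝ≥0∞) ^ ∑ i, (((Fin.consEquiv fun _ => S) (p, f) i : S) : ℕ)),
      pow_succ', ← ih, setGenFun, ← ENNReal.tsum_mul_right]
    refine tsum_congr fun p => ?_
    rw [← ENNReal.tsum_mul_left]
    refine tsum_congr fun f => ?_
    rw [Fin.sum_univ_succ, pow_add]
    simp [Fin.consEquiv]

/-- Geometric series over the length. In `ℝ≥0∞` no convergence hypothesis is needed: if the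
generating function is at least `1`, truncated subtraction gives `0⁻¹ = ∞`. -/
lemma tsum_lists (S : Set ℕ) (x : ℝ≥0) :
    ∑' l : List S, (x : ℝ≥0∞) ^ (l.map Subtype.val).sum = (1 - setGenFun S x)⁻¹ := by
  rw [← ENNReal.tsum_geometric, ← List.equivSigmaTuple.symm.tsum_eq, ENNReal.tsum_sigma']
  refine tsum_congr fun k => ?_
  rw [← tsum_tuples]
  refine tsum_congr fun f => ?_
  simp [List.equivSigmaTuple, List.map_ofFn, List.sum_ofFn]

lemma tsum_compCount {H : ℕ → ℤ} {m : ℕ} (hpos : ∀ i, m ≤ i → 0 < H i) (x : ℝ≥0) :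
    ∑' n, (compCount H m n : ℝ≥0∞) * (x : ℝ≥0∞) ^ n = (1 - setGenFun (partSet H m) x)⁻¹ := by
  let C : ℕ → Type := fun n => {c : Composition n // ∀ p ∈ c.blocks, ∃ i, m ≤ i ∧ (p : ℤ) = H i}
  let φ : List (partSet H m) → Σ n, C n := fun l =>
    ⟨(l.map Subtype.val).sum, ⟨⟨l.map Subtype.val, fun {p} hp => by
      obtain ⟨q, -, rfl⟩ := List.mem_map.1 hp
      obtain ⟨i, hi, hq⟩ := q.2
      exact_mod_cast hq ▸ hpos i hi, rfl⟩, fun p hp => by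
      obtain ⟨q, -, rfl⟩ := List.mem_map.1 hp
      exact q.2⟩⟩
  have hφ : Function.Bijective φ := by
    constructor
    · intro l l' hl
      have : (φ l).2.1.blocks = (φ l').2.1.blocks := by rw [hl]
      exact List.map_injective_iff.2 Subtype.val_injective this
    · rintro ⟨n, ⟨⟨b, hb, rfl⟩, hc⟩⟩
      refine ⟨b.attachWith (· ∈ partSet H m) hc, ?_⟩
      have hmap : (b.attachWith (· ∈ partSet H m) hc).map Subtype.val = b :=
        List.attachWith_map_subtype_val _
      simp only [φ]
      congr!
  rw [← tsum_lists, show ∑' l : List (partSet H m), (x : ℝ≥0∞) ^ (l.map Subtype.val).sum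
      = ∑' c : Σ n, C n, (x : ℝ≥0∞) ^ c.1 from
        (Equiv.ofBijective φ hφ).tsum_eq fun c : Σ n, C n => (x : ℝ≥0∞) ^ c.1,
    ENNReal.tsum_sigma']
  refine tsum_congr fun n => ?_
  have : Fintype (C n) := Fintype.ofFinite _
  change _ = ∑' _ : C n, (x : ℝ≥0∞) ^ n
  rw [tsum_fintype, sum_const, card_univ, nsmul_eq_mul, ← Nat.card_eq_fintype_card]
  rfl

lemma summable_compCount_iff {H : ℕ → ℤ} {m : ℕ} (hpos : ∀ i, m ≤ i → 0 < H i) (x : ℝ≥0) :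
    Summable (fun n => (compCount H m n : ℝ) * (x : ℝ) ^ n) ↔ setGenFun (partSet H m) x < 1 := by
  have h1 : Summable (fun n => (compCount H m n : ℝ) * (x : ℝ) ^ n) ↔
      Summable (fun n => (compCount H m n : ℝ≥0) * x ^ n) := by
    rw [← NNReal.summable_coe]
    push_cast
    rfl
  rw [h1, ← ENNReal.tsum_coe_ne_top_iff_summable]
  push_cast
  rw [tsum_compCount hpos, ENNReal.inv_ne_top, Ne, tsub_eq_zero_iff_le, not_le]

/-- A nonzero limit makes the two counting sequences of the same order, so their power series
converge at the same points. -/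
lemma setGenFun_lt_one_iff {G K : ℕ → ℤ} {m : ℕ} (hG : ∀ i, m ≤ i → 0 < G i)
    (hK : ∀ i, m ≤ i → 0 < K i) {ℓ : ℝ} (hℓ : 0 < ℓ)
    (h : Tendsto (fun n : ℕ => (compCount G m n : ℝ) / (compCount K m n : ℝ)) atTop (𝓝 ℓ))
    (x : ℝ≥0) : setGenFun (partSet G m) x < 1 ↔ setGenFun (partSet K m) x < 1 := by
  rw [← summable_compCount_iff hG, ← summable_compCount_iff hK]
  have hθ := (Asymptotics.isTheta_of_div_tendsto_nhds_ne_zero h hℓ.ne').mul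
    (Asymptotics.isTheta_refl (fun n : ℕ => (x : ℝ) ^ n) atTop)
  exact ⟨fun hs => summable_of_isBigO_nat hs hθ.1, fun hs => summable_of_isBigO_nat hs hθ.2⟩

/-- Termwise, `x ^ G i ≤ (x ^ θ) ^ K i` for `x ≤ 1`. The sums run over distinct values, so `K` must
be injective, whereas repetitions in `G` only help. -/
lemma setGenFun_le_rpow {G K : ℕ → ℤ} {m : ℕ} {θ : ℝ} (hG : ∀ i, m ≤ i → 0 < G i)
    (hK : ∀ i, m ≤ i → 0 < K i) (hinj : Set.InjOn K (Set.Ici m))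
    (hle : ∀ i, m ≤ i → θ * K i ≤ G i) {x : ℝ≥0} (hx0 : 0 < x) (hx1 : x ≤ 1) :
    setGenFun (partSet G m) x ≤ setGenFun (partSet K m) (x ^ θ) := by
  let γ : Set.Ici m → partSet G m := fun i =>
    ⟨(G i).toNat, i, i.2, Int.toNat_of_nonneg (hG i i.2).le⟩
  let κ : Set.Ici m → partSet K m := fun i =>
    ⟨(K i).toNat, i, i.2, Int.toNat_of_nonneg (hK i i.2).le⟩
  have hγ : Function.Surjective γ := by
    rintro ⟨p, i, hi, hp⟩
    exact ⟨⟨i, hi⟩, Subtype.ext (by simp [γ, ← hp])⟩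
  have hκ : Function.Injective κ := by
    intro i j hij
    have h1 : (K i).toNat = (K j).toNat := congrArg Subtype.val hij
    have h2 := hK i i.2
    have h3 := hK j j.2
    exact Subtype.ext (hinj i.2 j.2 (by omega))
  refine (ENNReal.tsum_le_tsum_comp_of_surjective hγ _).trans
    (le_trans (ENNReal.tsum_le_tsum fun i => ?_) (ENNReal.tsum_comp_le_tsum_of_injective hκ _))
  have hGi : ((G i).toNat : ℝ) = G i := by
    exact_mod_cast Int.toNat_of_nonneg (hG i i.2).le
  have hKi : ((K i).toNat : ℝ) = K i := by
    exact_mod_cast Int.toNat_of_nonneg (hK i i.2).le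
  simp only [γ, κ]
  rw [← ENNReal.coe_pow, ← ENNReal.coe_pow, ENNReal.coe_le_coe, ← NNReal.rpow_natCast,
    ← NNReal.rpow_natCast, ← NNReal.rpow_mul, hGi, hKi]
  exact NNReal.rpow_le_rpow_of_exponent_ge hx0 hx1 (hle i i.2)

/-- A property that holds near `0` and fails somewhere below `1` changes along some orbit of
`x ↦ x ^ θ`. -/
lemma exists_not_and_rpow {Q : ℝ≥0 → Prop} (hQ : ∀ x y, x ≤ y → Q y → Q x) {θ : ℝ} (hθ : 1 < θ)
    {x₀ x₁ : ℝ≥0} (hx₀ : 0 < x₀) (h₀ : Q x₀) (hx₁ : 0 < x₁) (hx₁' : x₁ < 1) (h₁ : ¬ Q x₁) :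
    ∃ x : ℝ≥0, 0 < x ∧ x ≤ 1 ∧ ¬ Q x ∧ Q (x ^ θ) := by
  have hex : ∃ k : ℕ, Q (x₁ ^ (θ ^ k)) := by
    have ht : Tendsto (fun k : ℕ => (x₁ : ℝ) ^ (θ ^ k)) atTop (𝓝 0) :=
      (tendsto_rpow_atTop_of_base_lt_one _ (neg_one_lt_zero.trans hx₁) hx₁').comp
        (tendsto_pow_atTop_atTop_of_one_lt hθ)
    obtain ⟨k, hk⟩ := (ht.eventually (gt_mem_nhds (show (0 : ℝ) < x₀ from hx₀))).exists
    exact ⟨k, hQ _ x₀ (by rw [← NNReal.coe_le_coe]; exact hk.le) h₀⟩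
  classical
  -- The least exponent is not `0` because `Q` fails at `x₁`; the point one step earlier is the
  -- required one.
  obtain ⟨k, hk⟩ : ∃ k, Nat.find hex = k + 1 := by
    refine Nat.exists_eq_succ_of_ne_zero fun h => h₁ ?_
    simpa [h] using Nat.find_spec hex
  refine ⟨x₁ ^ (θ ^ k), NNReal.rpow_pos hx₁,
    NNReal.rpow_le_one hx₁'.le (by positivity), Nat.find_min hex (by omega), ?_⟩
  rw [← NNReal.rpow_mul, ← pow_succ, ← hk]
  exact Nat.find_spec hex

/-- The sum is at most `∑_{n ≥ 1} 3^{-n} = 1/2`. -/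
lemma setGenFun_third_lt_one {S : Set ℕ} (hS : ∀ p ∈ S, 0 < p) : setGenFun S (1 / 3) < 1 := by
  have hinj : Function.Injective (fun p : S => (p : ℕ) - 1) := by
    intro p q hpq
    have := hS p p.2
    have := hS q q.2
    simp only at hpq
    exact Subtype.ext (by omega)
  calc setGenFun S (1 / 3)
      = ∑' p : S, (fun n : ℕ => ((1 / 3 : ℝ≥0) : ℝ≥0∞) ^ (n + 1)) ((p : ℕ) - 1) :=
        tsum_congr fun p => by
          simp only [Nat.sub_add_cancel (show 1 ≤ (p : ℕ) from hS p p.2)]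
    _ ≤ ∑' n : ℕ, ((1 / 3 : ℝ≥0) : ℝ≥0∞) ^ (n + 1) :=
        ENNReal.tsum_comp_le_tsum_of_injective hinj _
    _ < 1 := by
        have h : (1 : ℝ≥0) - 1 / 3 = 2 / 3 := by
          rw [tsub_eq_iff_eq_add_of_le (by rw [← NNReal.coe_le_coe]; norm_num)]
          norm_num
        rw [ENNReal.tsum_geometric_add_one, ← ENNReal.coe_one, ← ENNReal.coe_sub, h,
          ← ENNReal.coe_inv (by norm_num), ← ENNReal.coe_mul, ENNReal.coe_lt_coe,
          ← NNReal.coe_lt_coe]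
        norm_num

lemma exists_one_le_setGenFun {S : Set ℕ} {p q : ℕ} (hp : p ∈ S) (hq : q ∈ S) (hpq : p < q) :
    ∃ x : ℝ≥0, 0 < x ∧ x < 1 ∧ 1 ≤ setGenFun S x := by
  have hq0 : (q : ℝ) ≠ 0 := by
    have : q ≠ 0 := by omega
    exact_mod_cast this
  -- With `x ^ q = 1/2`, the parts `p` and `q` each contribute at least `1/2`.
  refine ⟨(1 / 2) ^ ((q : ℝ)⁻¹), NNReal.rpow_pos (by norm_num), ?_, ?_⟩
  · exact NNReal.rpow_lt_one (by rw [← NNReal.coe_lt_coe]; norm_num)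
      (by have : (0 : ℝ) ≤ q := by positivity
          positivity)
  · set x : ℝ≥0 := (1 / 2) ^ ((q : ℝ)⁻¹) with hx
    have hx1 : x ≤ 1 := NNReal.rpow_le_one (by rw [← NNReal.coe_le_coe]; norm_num) (by positivity)
    have hxq : x ^ q = 1 / 2 := by
      rw [hx, ← NNReal.rpow_natCast, ← NNReal.rpow_mul, inv_mul_cancel₀ hq0, NNReal.rpow_one]
    have hxp : x ^ q ≤ x ^ p := pow_le_pow_of_le_one zero_le hx1 hpq.le
    have hne : (⟨p, hp⟩ : S) ≠ ⟨q, hq⟩ := fun h => hpq.ne (congrArg Subtype.val h)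
    refine le_trans ?_ (ENNReal.sum_le_tsum {(⟨p, hp⟩ : S), ⟨q, hq⟩})
    rw [sum_pair hne, ← ENNReal.coe_pow, ← ENNReal.coe_pow, ← ENNReal.coe_add,
      ← ENNReal.coe_one, ENNReal.coe_le_coe]
    calc (1 : ℝ≥0) = x ^ q + x ^ q := by rw [hxq]; norm_num
      _ ≤ x ^ p + x ^ q := by gcongr

/-- If `G` exceeds `K` by a constant factor, then their generating functions cannot reach `1` at
the same point. -/
lemma false_of_ratio {G K : ℕ → ℤ} {m : ℕ} {θ : ℝ} (hθ : 1 < θ) (hG : ∀ i, m ≤ i → 0 < G i)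
    (hK : ∀ i, m ≤ i → 0 < K i) (hinj : Set.InjOn K (Set.Ici m))
    (hle : ∀ i, m ≤ i → θ * K i ≤ G i)
    (hiff : ∀ x, setGenFun (partSet G m) x < 1 ↔ setGenFun (partSet K m) x < 1)
    {x₁ : ℝ≥0} (hx₁ : 0 < x₁) (hx₁' : x₁ < 1) (h₁ : ¬ setGenFun (partSet K m) x₁ < 1) :
    False := by
  obtain ⟨x, hx0, hx1, hnot, hlt⟩ := exists_not_and_rpow
    (Q := fun x => setGenFun (partSet K m) x < 1)
    (fun x y hxy hy => (setGenFun_mono _ hxy).trans_lt hy) hθ (x₀ := 1 / 3) (by norm_num)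
    (setGenFun_third_lt_one (by
      rintro p ⟨i, hi, hp⟩
      exact_mod_cast hp ▸ hK i hi)) hx₁ hx₁' h₁
  exact hnot ((hiff x).1 ((setGenFun_le_rpow hG hK hinj hle hx0 hx1).trans_lt hlt))

/-! ### Monotonicity of positive linear recurrences -/

namespace IsShiftedPLRS

variable {L : ℕ} {a : ℕ → ℕ} {h : ℕ → ℝ}

lemma first_mul_add_le (H : IsShiftedPLRS L a h) (n : ℕ) :
    a 0 * h n + (if n + 1 < L then 1 else 0) ≤ h (n + 1) := by
  rw [H.eq_sum (n + 1)]
  gcongr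
  exact single_le_sum (f := fun i => (a i : ℝ) * h (n + 1 - 1 - i))
    (fun i _ => mul_nonneg (by positivity) (H.nonneg _)) (mem_range.2 n.succ_pos)

lemma monotone (H : IsShiftedPLRS L a h) : Monotone h :=
  monotone_nat_of_le_succ fun n => by
    have h1 : (1 : ℝ) ≤ a 0 := by exact_mod_cast H.first_pos
    have h2 : (0 : ℝ) ≤ if n + 1 < L then 1 else 0 := by split_ifs <;> norm_num
    nlinarith [H.first_mul_add_le n, H.nonneg n]

lemma pos_apply (H : IsShiftedPLRS L a h) (n : ℕ) : 0 < h n :=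
  one_pos.trans_le ((H.one_le H.pos).trans (H.monotone n.zero_le))

lemma strictMono_or_eq_one (H : IsShiftedPLRS L a h) : StrictMono h ∨ ∀ n, h n = 1 := by
  have ha : (1 : ℝ) ≤ a 0 := by exact_mod_cast H.first_pos
  by_cases hL : L = 1
  · subst hL
    by_cases ha1 : a 0 = 1
    · right
      intro n
      induction n with
      | zero => simpa using H.eq_sum 0
      | succ n ih =>
        rw [H.eq_sum, sum_range_succ', sum_eq_zero, ha1, if_neg (by omega)]
        · simpa using ih
        · intro i _
          rw [H.eq_zero (i + 1) (by omega)]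
          simp
    · left
      refine strictMono_nat_of_lt_succ fun n => ?_
      have h2 : (2 : ℝ) ≤ a 0 := by
        have := H.first_pos
        exact_mod_cast (show 2 ≤ a 0 by omega)
      have := H.first_mul_add_le n
      rw [if_neg (by omega)] at this
      nlinarith [H.pos_apply n]
  · left
    refine strictMono_nat_of_lt_succ fun n => ?_
    by_cases hn : n + 1 < L
    · have := H.first_mul_add_le n
      rw [if_pos hn] at this
      nlinarith [H.pos_apply n]
    · have hpos := H.pos
      have hlast : (1 : ℝ) ≤ a (L - 1) := by exact_mod_cast H.last_pos
      -- Here `L ≥ 2`, so the first and last coefficients are distinct terms and give `h (n + 1) ≥ h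
      -- n + h (n - (L - 1))`.
      have hsub : ({0, L - 1} : Finset ℕ) ⊆ range (n + 1) := by
        intro i hi
        simp only [mem_insert, mem_singleton] at hi
        exact mem_range.2 (by omega)
      have hle := sum_le_sum_of_subset_of_nonneg hsub
        (f := fun i => (a i : ℝ) * h (n + 1 - 1 - i))
        fun i _ _ => mul_nonneg (by positivity) (H.nonneg _)
      rw [sum_pair (by omega)] at hle
      rw [H.eq_sum (n + 1), if_neg hn, add_zero]
      refine lt_of_lt_of_le ?_ hle
      rw [Nat.add_sub_cancel, Nat.sub_zero]
      nlinarith [H.pos_apply n, H.pos_apply (n - (L - 1))]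

end IsShiftedPLRS

/-! ### Fibonacci parts and the main equivalence -/

lemma fibSeq_pos (n : ℕ) : 0 < fibSeq n := by
  simp [fibSeq]

lemma fibSeq_injOn (m : ℕ) (hm : 1 ≤ m) : Set.InjOn fibSeq (Set.Ici m) := by
  intro i hi j hj hij
  have hi : m ≤ i := hi
  have hj : m ≤ j := hj
  have h : Nat.fib (i - 1 + 2) = Nat.fib (j - 1 + 2) := by
    rw [show i - 1 + 2 = i + 1 by omega, show j - 1 + 2 = j + 1 by omega]
    exact Nat.cast_injective (R := ℤ) hij
  have := Nat.fib_add_two_strictMono.injective h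
  omega

lemma exists_not_setGenFun_fibSeq_lt_one (m : ℕ) (hm : 1 ≤ m) :
    ∃ x : ℝ≥0, 0 < x ∧ x < 1 ∧ ¬ setGenFun (partSet fibSeq m) x < 1 := by
  simp only [not_lt]
  refine exists_one_le_setGenFun (p := Nat.fib (m + 1)) (q := Nat.fib (m + 2)) ⟨m, le_rfl, rfl⟩
    ⟨m + 1, by omega, rfl⟩ ?_
  exact Nat.fib_lt_fib_succ (by omega)

/-- Consecutive Fibonacci numbers are coprime, so two adjacent parts already represent every large
`n`. This excludes the value `0 / 0 = 0` in the ratio. -/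
lemma eventually_compCount_fibSeq_ne_zero (m : ℕ) :
    ∀ᶠ n in atTop, compCount fibSeq m n ≠ 0 := by
  filter_upwards [eventually_ge_atTop ((Nat.fib (m + 1)).pred * (Nat.fib (m + 2)).pred)] with n hn
  obtain ⟨b, c, hbc⟩ := Nat.exists_add_mul_eq_of_gcd_dvd_of_mul_pred_le _ _ n
    (by rw [(Nat.fib_coprime_fib_succ (m + 1)).gcd_eq_one]; exact one_dvd n) hn
  let l := List.replicate b (Nat.fib (m + 1)) ++ List.replicate c (Nat.fib (m + 2))
  have hl : ∀ p ∈ l, ∃ i, m ≤ i ∧ (p : ℤ) = fibSeq i := by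
    intro p hp
    rcases List.mem_append.1 hp with hp | hp
    · exact ⟨m, le_rfl, by rw [List.eq_of_mem_replicate hp]; rfl⟩
    · exact ⟨m + 1, by omega, by rw [List.eq_of_mem_replicate hp]; rfl⟩
  have : Nonempty {c : Composition n // ∀ p ∈ c.blocks, ∃ i, m ≤ i ∧ (p : ℤ) = fibSeq i} :=
    ⟨⟨⟨l, fun {p} hp => by
      obtain ⟨i, -, hi⟩ := hl p hp
      exact_mod_cast hi ▸ fibSeq_pos i, by simpa [l] using hbc⟩, hl⟩⟩
  exact Nat.card_pos.ne'

lemma tendsto_compCount_div_of_eq_fibSeq {H : ℕ → ℤ} (hH : ∀ m, 1 ≤ m → H m = fibSeq m) {m : ℕ}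
    (hm : 1 ≤ m) :
    Tendsto (fun n : ℕ => (compCount H m n : ℝ) / (compCount fibSeq m n : ℝ)) atTop (𝓝 1) := by
  have heq : ∀ n, compCount H m n = compCount fibSeq m n := by
    intro n
    unfold compCount
    have : ∀ p : ℕ, (∃ i, m ≤ i ∧ (p : ℤ) = H i) ↔ ∃ i, m ≤ i ∧ (p : ℤ) = fibSeq i := fun p =>
      exists_congr fun i => and_congr_right fun hi => by rw [hH i (hm.trans hi)]
    simp only [this]
  refine tendsto_const_nhds.congr' ?_
  filter_upwards [eventually_compCount_fibSeq_ne_zero m] with n hn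
  rw [heq, div_self (Nat.cast_ne_zero.2 hn)]

theorem theorem5p2 (H : ℕ → ℤ) (hH : IsPLRS H) :
    (∀ m : ℕ, 2 ≤ m → ∃ ℓ : ℝ, 0 < ℓ ∧
      Filter.Tendsto (fun n : ℕ => (compCount H m n : ℝ) / (compCount fibSeq m n : ℝ))
        Filter.atTop (nhds ℓ)) ↔
    ∀ m : ℕ, 1 ≤ m → H m = fibSeq m := by
  refine ⟨fun hlim => ?_, fun heq m hm =>
    ⟨1, one_pos, tendsto_compCount_div_of_eq_fibSeq heq (by omega)⟩⟩
  obtain ⟨L, a, hS⟩ := hH.exists_isShiftedPLRS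
  have hpos : ∀ i, 1 ≤ i → 0 < H i := by
    intro i hi
    have := hS.pos_apply (i - 1)
    rw [Nat.sub_add_cancel hi] at this
    exact_mod_cast this
  have hiff : ∀ m, 2 ≤ m → ∀ x, setGenFun (partSet H m) x < 1 ↔
      setGenFun (partSet fibSeq m) x < 1 := by
    intro m hm x
    obtain ⟨ℓ, hℓ, ht⟩ := hlim m hm
    exact setGenFun_lt_one_iff (fun i hi => hpos i (by omega)) (fun i _ => fibSeq_pos i) hℓ ht x
  -- The limit hypothesis holds for all `m ≥ 2`, so `m` may be taken past the point where an
  -- eventual inequality starts.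
  have hshift : ∀ {P : ℕ → Prop}, (∀ᶠ n in atTop, P (n + 1)) → ∃ m, 2 ≤ m ∧ ∀ i, m ≤ i → P i := by
    intro P hP
    obtain ⟨N, hN⟩ := eventually_atTop.1 hP
    refine ⟨N + 2, by omega, fun i hi => ?_⟩
    have := hN (i - 1) (by omega)
    rwa [Nat.sub_add_cancel (by omega)] at this
  rcases hS.trichotomy with heq | ⟨θ, hθ, hev⟩ | ⟨θ, hθ, hev⟩
  · intro m hm
    have := heq (m - 1)
    rw [Nat.sub_add_cancel hm] at this
    exact_mod_cast this
  · obtain ⟨m, hm, hle⟩ := hshift (P := fun i => θ * fibSeq i ≤ H i) hev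
    obtain ⟨x, hx0, hx1, hx⟩ := exists_not_setGenFun_fibSeq_lt_one m (by omega)
    exact (false_of_ratio hθ (fun i hi => hpos i (by omega)) (fun i _ => fibSeq_pos i)
      (fibSeq_injOn m (by omega)) hle (hiff m hm) hx0 hx1 hx).elim
  · obtain ⟨m, hm, hle⟩ := hshift (P := fun i => θ * H i ≤ fibSeq i) hev
    obtain ⟨x, hx0, hx1, hx⟩ := exists_not_setGenFun_fibSeq_lt_one m (by omega)
    rw [← hiff m hm] at hx
    rcases hS.strictMono_or_eq_one with hmono | hone
    · have hinj : Set.InjOn H (Set.Ici m) := by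
        intro i hi j hj hij
        have hi : m ≤ i := hi
        have hj : m ≤ j := hj
        have : i - 1 = j - 1 := hmono.injective (by
          simp only [Nat.sub_add_cancel (show 1 ≤ i by omega),
            Nat.sub_add_cancel (show 1 ≤ j by omega), hij])
        omega
      exact (false_of_ratio hθ (fun i _ => fibSeq_pos i) (fun i hi => hpos i (by omega)) hinj hle
        (fun x => (hiff m hm x).symm) hx0 hx1 hx).elim
    -- A constant `H` is not injective, but its only part is `1`, so its generating function is `x <
    -- 1`.
    · have hset : partSet H m = {1} := by
        have h1 : ∀ i, m ≤ i → H i = 1 := by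
          intro i hi
          have := hone (i - 1)
          rw [Nat.sub_add_cancel (by omega)] at this
          exact_mod_cast this
        ext p
        constructor
        · rintro ⟨i, hi, hp⟩
          rw [h1 i hi] at hp
          exact_mod_cast hp
        · rintro rfl
          exact ⟨m, le_rfl, by simp [h1 m le_rfl]⟩
      refine absurd ?_ hx
      rw [hset, setGenFun, tsum_singleton 1 (fun p : ℕ => (x : ℝ≥0∞) ^ p), pow_one]
      exact_mod_cast hx1
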